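/- Let $E$ be a topos (a category with finite limits and a Grothendieck topology), and let $F_n\to\cdots\to F_2\to F_1\to E$, $n\ge 2$, be an $n$-gerbed tower with commutative bands $L_1,\dots,L_n$ (sheaves of abelian groups on $E$). This means: (a) Each $F_l$ has objects, to each of which is attached a topos, and arrows (the "2-arrows"), each of which induces a continuous map of these toposes. $F_1\to E$ is a gerbe bounded by $L_1$, and $p_l:F_l\to F_{l-1}$ ($l\ge2$) is the projection. (b) For every object $U$ of $F_{l-1}$, the fibre of $F_l$ over $U$ is a gerbe on the topos attached to $U$, bounded by a sheaf whose global sections are those of $L_l$ on the image of $U$ in $E$. Objects of this fibre over the terminal object of the topos of $U$ are called global. (c) 2-arrows over invertible underlying arrows are invertible. There are strict restriction functors on the fibres of the $F_l$ over $E$, given by inverse images and compatible with the projections $p_l$. (d) For every 2-arrow $u:U_1\to U_2$ of $F_l$ and every object $V_2$ over $U_2$ there is a 2-arrow $V_1\to V_2$ of $F_{l+1}$ over $u$. Suppose further that there is an abelian sheaf $L_2'$ on $E$ with morphisms of sheaves $L_2\to L_2'\to L_1$ such that, for every global object $V$ of $F_2$ with image $X$ in $E$, the group of automorphisms of $V$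 whose image in $F_1$ belongs to $L_1(X)$ is identified with $L_2'(X)$, compatibly with restrictions, with the inclusion of the band $L_2$, and with the projection to $L_1$. Let $(U_i)_{i\in I}$ be a covering family of $E$. Write $U_{i_1\dots i_p}$ for the products of the $U_i$ over the final object, and let upper indices denote restriction. Choose objects $u_i$ of $F_1$ over $U_i$ and arrows $v_{i_1i_2}:u_{i_2}^{i_1}\to u_{i_1}^{i_2}$ over $U_{i_1i_2}$. Let $$c_{i_1i_2i_3}=\bigl(v_{i_1i_3}^{\,i_2}\bigr)^{-1}\,v_{i_1i_2}^{\,i_3}\,v_{i_2i_3}^{\,i_1}\in \mathrm{Aut}(u_{i_3}^{i_1i_2})$$ be the classifying 2-cocycle of the gerbe $F_1\to E$. 1. If for all $i_1,i_2,i_3$ there is a global object of $F_2$ over $u_{i_3}^{i_1i_2}$ and any two of them are isomorphic over $u_{i_3}^{i_1i_2}$, then there exist global objects $u_{i_1i_2i_3}$ of $F_2$ over $u_{i_3}^{i_1i_2}$ and automorphisms $c_{i_1i_2i_3}^*$ of $u_{i_1i_2i_3}$ over $c_{i_1i_2i_3}$. 2. For every choice of such $u_{i_1i_2i_3}$ and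 $c^*_{i_1i_2i_3}$, let $c_{i_1i_2i_3i_4}$ be the automorphism of $u_{i_1i_2i_3}^{i_4}$ given by $$c_{i_1i_2i_3i_4}=(c_{i_2i_3i_4}^*)^{i_1}-(c_{i_1i_3i_4}^*)^{i_2}+(c_{i_1i_2i_4}^*)^{i_3}-(c_{i_1i_2i_3}^*)^{i_4},$$ the sum being taken in $L_2'(U_{i_1i_2i_3i_4})$, with which the automorphism groups of the four objects are identified. Then each $c_{i_1i_2i_3i_4}$ is the action of a unique element of the band $L_2(U_{i_1i_2i_3i_4})$, and the family $(c_{i_1i_2i_3i_4})$ is a Čech cocycle (of degree 3) with values in $L_2$: its Čech boundary, with values in the groups $L_2(U_{i_1\dots i_5})$, is zero. -/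

import Mathlib

open CategoryTheory CategoryTheory.Limits Opposite

universe w v u v₁ u₁ v₂ u₂ v₃ u₃

namespace GerbeTheory

/-! ### Functors between fibres -/

section Fibres

variable {𝒜 : Type u₁} [Category.{v₁} 𝒜] {𝒞 : Type u₂} [Category.{v₂} 𝒞]
  {𝒮 : Type u₃} [Category.{v₃} 𝒮]

/-- The functor induced by `p` from the fibre of `p ⋙ r` over `X` to the fibre of `r` over `X`. -/
def fibreMap (p : 𝒜 ⥤ 𝒞) (r : 𝒞 ⥤ 𝒮) (X : 𝒮) :
    Functor.Fiber (p ⋙ r) X ⥤ Functor.Fiber r X where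
  obj a := ⟨p.obj a.1, a.2⟩
  map {a b} φ := ⟨p.map φ.1, by
    have h := φ.2
    exact IsHomLift.of_fac' r (𝟙 X) (p.map φ.1) a.2 b.2
      (IsHomLift.fac' (p ⋙ r) (𝟙 X) φ.1)⟩
  map_id a := Subtype.ext (p.map_id a.1)
  map_comp φ ψ := Subtype.ext (p.map_comp φ.1 ψ.1)

/-- If `U` lies over `X`, the fibre of `p` over `U` maps to the fibre of `p ⋙ r` over `X`. -/
def fibreOver (p : 𝒜 ⥤ 𝒞) (r : 𝒞 ⥤ 𝒮) {X : 𝒮} {U : 𝒞} (hU : r.obj U = X) :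
    Functor.Fiber p U ⥤ Functor.Fiber (p ⋙ r) X where
  obj a := ⟨a.1, (congrArg r.obj a.2).trans hU⟩
  map {a b} φ := ⟨φ.1, by
    have h := φ.2
    refine IsHomLift.of_fac' (p ⋙ r) (𝟙 X) φ.1 ((congrArg r.obj a.2).trans hU)
      ((congrArg r.obj b.2).trans hU) ?_
    have e : p.map φ.1 = eqToHom (a.2.trans b.2.symm) := by
      rw [IsHomLift.fac' p (𝟙 U) φ.1]; simp
    simp [e, eqToHom_map]⟩

end Fibres

/-! ### Gerbes and their bands -/

section Gerbes

variable {𝒢 : Type u₁} [Category.{v₁} 𝒢] {C : Type u₂} [Category.{v₂} C]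

/-- A category fibered in groupoids: arrows of the base lift, and every arrow upstairs
satisfies the unique factorization property. -/
structure IsFiberedInGroupoids (p : 𝒢 ⥤ C) : Prop where
  exists_lift : ∀ {a : 𝒢} {R : C} (f : R ⟶ p.obj a), ∃ (b : 𝒢) (φ : b ⟶ a), p.IsHomLift f φ
  cartesian : ∀ {a b : 𝒢} (φ : a ⟶ b), p.IsStronglyCartesian (p.map φ) φ

/-- A gerbe `p : 𝒢 ⥤ C` on the site `(C, J)`: a category fibered in groupoids in which arrows
glue, objects glue, and which is locally non-empty and locally connected. -/
structure IsGerbe (J : GrothendieckTopology C) (p : 𝒢 ⥤ C) : Prop where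
  fibered : IsFiberedInGroupoids p
  /-- Gluing of arrows. An arrow `x ⟶ y` over `X` is given, locally on a covering sieve `S`, by
  its composites `ψ` with all the inverse images `z ⟶ x` of `x` along the arrows of `S`. -/
  glue_hom : ∀ {X : C} (S : Sieve X) (_ : S ∈ J X) (x y : p.Fiber X)
    (ψ : ∀ {Y : C} (f : Y ⟶ X) (_ : S f) (z : p.Fiber Y) (a : z.1 ⟶ x.1)
      (_ : p.IsHomLift f a), (z.1 ⟶ y.1))
    (_ : ∀ {Y : C} (f : Y ⟶ X) (hf : S f) (z : p.Fiber Y) (a : z.1 ⟶ x.1)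
      (ha : p.IsHomLift f a), p.IsHomLift f (ψ f hf z a ha))
    (_ : ∀ {Y Y' : C} (f : Y ⟶ X) (hf : S f) (z : p.Fiber Y) (a : z.1 ⟶ x.1)
      (ha : p.IsHomLift f a) (g : Y' ⟶ Y) (z' : p.Fiber Y') (b : z'.1 ⟶ z.1)
      (_ : p.IsHomLift g b),
      ψ (g ≫ f) (S.downward_closed hf g) z' (b ≫ a) inferInstance = b ≫ ψ f hf z a ha),
    ∃! φ : x ⟶ y, ∀ {Y : C} (f : Y ⟶ X) (hf : S f) (z : p.Fiber Y) (a : z.1 ⟶ x.1)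
      (ha : p.IsHomLift f a), ψ f hf z a ha = a ≫ φ.1
  /-- Gluing of objects. A descent datum on a covering sieve `S` is a functor `D` from `S` to `𝒢`
  over `C`; it comes from an object `x` over `X`. -/
  glue_obj : ∀ {X : C} (S : Sieve X) (_ : S ∈ J X) (D : S.arrows.category ⥤ 𝒢)
    (_ : ∀ {f g : S.arrows.category} (m : f ⟶ g), p.IsHomLift m.hom.left (D.map m)),
    ∃ (x : p.Fiber X) (a : ∀ f : S.arrows.category, D.obj f ⟶ x.1),
      (∀ f : S.arrows.category, p.IsHomLift f.obj.hom (a f)) ∧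
      ∀ {f g : S.arrows.category} (m : f ⟶ g), D.map m ≫ a g = a f
  locally_nonempty : ∀ X : C, ∃ S ∈ J X, ∀ {Y : C} (f : Y ⟶ X), S f → Nonempty (p.Fiber Y)
  locally_connected : ∀ {X : C} (x y : p.Fiber X), ∃ S ∈ J X, ∀ {Y : C} (f : Y ⟶ X), S f →
    ∃ (z : p.Fiber Y) (a : z.1 ⟶ x.1) (b : z.1 ⟶ y.1), p.IsHomLift f a ∧ p.IsHomLift f b

/-- The fibered category `p : 𝒢 ⥤ C` is bounded by the commutative sheaf `L`: for every object `x`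
over `X`, an isomorphism of `L(X)` with the group of automorphisms of `x` over `X`, which commutes
with restrictions and with morphisms between objects. -/
structure Banding (p : 𝒢 ⥤ C) {J : GrothendieckTopology C} (L : Sheaf J AddCommGrpCat.{w}) where
  aut : ∀ {X : C} (x : p.Fiber X), Multiplicative (L.obj.obj (op X)) ≃* Aut x
  natural : ∀ {X Y : C} (f : X ⟶ Y) (x : p.Fiber X) (y : p.Fiber Y) (a : x.1 ⟶ y.1)
    (_ : p.IsHomLift f a) (s : L.obj.obj (op Y)),
    (aut x (Multiplicative.ofAdd ((L.obj.map f.op).hom s))).hom.1 ≫ a =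
      a ≫ (aut y (Multiplicative.ofAdd s)).hom.1

end Gerbes

/-! ### Families of toposes parametrized by a category -/

section Topoi

variable {ℬ : Type u₁} [Category.{v₁} ℬ] {ℱ : Type u₂} [Category.{v₂} ℱ]

/-- For `w : W' ⟶ W` over `u : U' ⟶ U` and a sieve `S` on `W`, the sieve on `W'` of the arrows
which are carried by `w` into `S`. When `w` is cartesian this is the inverse image of `S` by `u`. -/
def inverseImageSieve (t : ℬ ⥤ ℱ) {U' U : ℱ} (u : U' ⟶ U) {W' : t.Fiber U'} {W : t.Fiber U}
    (w : W'.1 ⟶ W.1) (S : Sieve W) : Sieve W' where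
  arrows Y' g := ∃ (Y : t.Fiber U) (f : Y ⟶ W) (y : Y'.1 ⟶ Y.1),
    S f ∧ t.IsHomLift u y ∧ y ≫ f.1 = g.1 ≫ w
  downward_closed := by
    rintro Y' Z' g ⟨Y, f, y, hf, hy, e⟩ h
    refine ⟨Y, f, h.1 ≫ y, hf, ?_, ?_⟩
    · have := h.2
      infer_instance
    · have e' : (h ≫ g).1 = h.1 ≫ g.1 := rfl
      rw [e', Category.assoc, Category.assoc, e]

/-- The fibered category `t : ℬ ⥤ ℱ` attaches a topos to every object `U` of `ℱ`, namely the
fibre `t.Fiber U` with its finite limits and the topology `top U`, and a continuous map to every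
arrow `u` of `ℱ`: the inverse image by `u` preserves finite limits (terminal objects and fibre
products) and covering sieves. -/
structure IsToposFamily (t : ℬ ⥤ ℱ) (top : ∀ U : ℱ, GrothendieckTopology (t.Fiber U)) : Prop where
  fibered : t.IsFibered
  finiteLimits : ∀ U : ℱ, HasFiniteLimits (t.Fiber U)
  terminal : ∀ {U' U : ℱ} (u : U' ⟶ U) (W' : t.Fiber U') (W : t.Fiber U) (w : W'.1 ⟶ W.1)
    (_ : t.IsCartesian u w), Nonempty (IsTerminal W) → Nonempty (IsTerminal W')
  pullback : ∀ {U' U : ℱ} (u : U' ⟶ U) {P' X' Y' Z' : t.Fiber U'} {P X Y Z : t.Fiber U}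
    {fst : P ⟶ X} {snd : P ⟶ Y} {f : X ⟶ Z} {g : Y ⟶ Z}
    {fst' : P' ⟶ X'} {snd' : P' ⟶ Y'} {f' : X' ⟶ Z'} {g' : Y' ⟶ Z'}
    (a : P'.1 ⟶ P.1) (b : X'.1 ⟶ X.1) (c : Y'.1 ⟶ Y.1) (d : Z'.1 ⟶ Z.1)
    (_ : t.IsCartesian u a) (_ : t.IsCartesian u b) (_ : t.IsCartesian u c)
    (_ : t.IsCartesian u d)
    (_ : fst'.1 ≫ b = a ≫ fst.1) (_ : snd'.1 ≫ c = a ≫ snd.1)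
    (_ : f'.1 ≫ d = b ≫ f.1) (_ : g'.1 ≫ d = c ≫ g.1),
    IsPullback fst snd f g → IsPullback fst' snd' f' g'
  cover : ∀ {U' U : ℱ} (u : U' ⟶ U) (W' : t.Fiber U') (W : t.Fiber U) (w : W'.1 ⟶ W.1)
    (_ : t.IsCartesian u w) (S : Sieve W), S ∈ top U W →
      inverseImageSieve t u w S ∈ top U' W'

end Topoi

/-! ### Gerbed towers -/

/-- The sequences `⋯ ⟶ F₃ ⟶ F₂ ⟶ F₁ ⟶ E` underlying a gerbed tower. Here `F l` stands for the
member `F_{l+1}` of the sequence. The arrows of the category `F l` are the `2`-arrows of `F_{l+1}`.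
To each object `U` of `F l` is attached a topos, the fibre over `U` of `t l : B l ⥤ F l`,
and to each arrow of `F l` a continuous map between these toposes.
An object of `F (l + 1)` lies over an object of the topos of some object of `F l`. The `1`-arrow
underlying an arrow of `F (l + 1)` (of `F 0`) is its image in `B l` (in `E`). -/
structure ToposSequence (E : Type u) [Category.{v} E] where
  F : ℕ → Type u₁
  [catF : ∀ l, Category.{v₁} (F l)]
  B : ℕ → Type u₂
  [catB : ∀ l, Category.{v₂} (B l)]
  base : F 0 ⥤ E
  t : ∀ l, B l ⥤ F l
  top : ∀ l (U : F l), GrothendieckTopology ((t l).Fiber U)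
  topos : ∀ l, IsToposFamily (t l) (top l)
  q : ∀ l, F (l + 1) ⥤ B l

namespace ToposSequence

attribute [instance] catF catB

variable {E : Type u} [Category.{v} E] (T : ToposSequence.{v, u, v₁, u₁, v₂, u₂} E)

/-- The projection from a member of the sequence to the preceding one. -/
abbrev p (l : ℕ) : T.F (l + 1) ⥤ T.F l := T.q l ⋙ T.t l

/-- The projection to `E`. -/
def proj : ∀ l : ℕ, T.F l ⥤ E
  | 0 => T.base
  | l + 1 => T.p l ⋙ proj l

/-- The projection on the fibres over an object `X` of `E`. -/
abbrev down (l : ℕ) (X : E) : (T.proj (l + 1)).Fiber X ⥤ (T.proj l).Fiber X :=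
  fibreMap (T.p l) (T.proj l) X

/-- The fibre of `F (l + 1)` over an object `U` of `F l`, as a category over the topos of `U`. -/
abbrev fibreFunctor (l : ℕ) (U : T.F l) : (T.p l).Fiber U ⥤ (T.t l).Fiber U :=
  fibreMap (T.q l) (T.t l) U

/-- The object of the topos of `(T.p l).obj V` over which `V` lies. -/
abbrev baseObj (l : ℕ) (V : T.F (l + 1)) : (T.t l).Fiber ((T.p l).obj V) :=
  Functor.Fiber.mk (a := (T.q l).obj V) rfl

/-- `V` is a global object: it lies over the terminal object of the topos of its projection. -/
def IsGlobal (l : ℕ) (V : T.F (l + 1)) : Prop :=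
  Nonempty (IsTerminal (T.baseObj l V))

/-- Strict restriction functors on the fibres of `F l` over `E`; the restriction of `x` is an
inverse image of `x`, i.e. it comes with an arrow to `x`. -/
structure Restriction (l : ℕ) where
  res : ∀ {X Y : E} (_ : X ⟶ Y), (T.proj l).Fiber Y ⥤ (T.proj l).Fiber X
  arr : ∀ {X Y : E} (f : X ⟶ Y),
    res f ⋙ Functor.Fiber.fiberInclusion ⟶ Functor.Fiber.fiberInclusion
  arr_lift : ∀ {X Y : E} (f : X ⟶ Y) (x : (T.proj l).Fiber Y),
    (T.proj l).IsHomLift f ((arr f).app x)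
  res_id : ∀ X : E, res (𝟙 X) = 𝟭 _
  res_comp : ∀ {X Y Z : E} (f : X ⟶ Y) (g : Y ⟶ Z), res (f ≫ g) = res g ⋙ res f

end ToposSequence

/-- An `n`-gerbed tower `F_n ⟶ ⋯ ⟶ F₁ ⟶ E` over the site `(E, J)` with commutative bands
(only the members `F l` with `l < n` matter). The sheaf `L l` is the member `L_{l+1}` of the
family of bands. -/
structure GerbedTower {E : Type u} [Category.{v} E] (J : GrothendieckTopology E) (n : ℕ)
    extends ToposSequence.{v, u, v₁, u₁, v₂, u₂} E where
  L : ℕ → Sheaf J AddCommGrpCat.{w}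
  /-- `F₁ ⟶ E` is a gerbe bounded by `L₁`. -/
  gerbe_base : IsGerbe J base
  band_base : Banding base (L 0)
  /-- A `2`-arrow over an invertible `1`-arrow is invertible. -/
  isIso_of_isIso : ∀ (l : ℕ) {V V' : F (l + 1)} (φ : V ⟶ V'), IsIso ((q l).map φ) → IsIso φ
  /-- The restriction functors. -/
  restr : ∀ l, toToposSequence.Restriction l
  restr_down : ∀ (l : ℕ) {X Y : E} (f : X ⟶ Y),
    (restr (l + 1)).res f ⋙ toToposSequence.down l X =
      toToposSequence.down l Y ⋙ (restr l).res f
  restr_arr : ∀ (l : ℕ) {X Y : E} (f : X ⟶ Y) (x : (toToposSequence.proj (l + 1)).Fiber Y),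
    (toToposSequence.p l).IsHomLift (((restr l).arr f).app ((toToposSequence.down l Y).obj x))
      (((restr (l + 1)).arr f).app x)
  /-- The restriction of `x` lies over the inverse image of the object over which `x` lies. -/
  restr_base : ∀ (l : ℕ) {X Y : E} (f : X ⟶ Y) (x : (toToposSequence.proj (l + 1)).Fiber Y),
    (t l).IsCartesian ((toToposSequence.p l).map (((restr (l + 1)).arr f).app x))
      ((q l).map (((restr (l + 1)).arr f).app x))
  /-- The fibre of `F (l + 1)` over an object `U` of `F l` is a gerbe on the topos of `U`, bounded
  by the sheaf `LU l U` which `L (l + 1)` induces there: its global sections are those of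
  `L (l + 1)` on the projection of `U` to `E`. -/
  gerbe_fibre : ∀ (l : ℕ) (_ : l + 1 < n) (U : F l),
    IsGerbe (top l U) (toToposSequence.fibreFunctor l U)
  LU : ∀ (l : ℕ) (U : F l), Sheaf (top l U) AddCommGrpCat.{w}
  band_fibre : ∀ (l : ℕ) (_ : l + 1 < n) (U : F l),
    Banding (toToposSequence.fibreFunctor l U) (LU l U)
  globalSections : ∀ (l : ℕ) (_ : l + 1 < n) (U : F l) (W : (t l).Fiber U) (_ : IsTerminal W),
    (L (l + 1)).obj.obj (op ((toToposSequence.proj l).obj U)) ≃+ (LU l U).obj.obj (op W)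
  globalSections_natural : ∀ (l : ℕ) (hl : l + 1 < n) (U : F l) (W W' : (t l).Fiber U)
    (hW : IsTerminal W) (hW' : IsTerminal W') (f : W' ⟶ W)
    (s : (L (l + 1)).obj.obj (op ((toToposSequence.proj l).obj U))),
    ((LU l U).obj.map f.op).hom (globalSections l hl U W hW s) = globalSections l hl U W' hW' s
  /-- Lifting of arrows: for `u : U₁ ⟶ U₂` in `F l` and `V₂` over `U₂` there is an arrow over `u`
  with target `V₂`; it lies over the inverse image by `u` of the object over which `V₂` lies. -/
  exists_lift : ∀ (l : ℕ) {U₁ U₂ : F l} (u : U₁ ⟶ U₂) (V₂ : (toToposSequence.p l).Fiber U₂),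
    ∃ (V₁ : (toToposSequence.p l).Fiber U₁) (φ : V₁.1 ⟶ V₂.1),
      (toToposSequence.p l).IsHomLift u φ ∧ (t l).IsCartesian u ((q l).map φ)

namespace GerbedTower

variable {E : Type u} [Category.{v} E] {J : GrothendieckTopology E} {n : ℕ}
  (T : GerbedTower.{w, v, u, v₁, u₁, v₂, u₂} J n)

/-- Restrictions of global objects are global. -/
theorem isGlobal_res (l : ℕ) {X Y : E} (f : X ⟶ Y) (x : (T.proj (l + 1)).Fiber Y)
    (hx : T.IsGlobal l x.1) : T.IsGlobal l (((T.restr (l + 1)).res f).obj x).1 :=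
  (T.topos l).terminal _ (T.baseObj l _) (T.baseObj l _) _ (T.restr_base l f x) hx

/-- The action of the band on a global object: a section of `L (l + 1)` over `X` defines an
automorphism of every global object `x` of `F (l + 1)` over `X`. -/
def bandAut (l : ℕ) (hl : l + 1 < n) {X : E} (x : (T.proj (l + 1)).Fiber X)
    (hx : IsTerminal (T.baseObj l x.1))
    (s : (T.L (l + 1)).obj.obj (op X)) : Aut x :=
  let U : T.F l := (T.p l).obj x.1
  let V : (T.p l).Fiber U := Functor.Fiber.mk (a := x.1) rfl
  let y : (T.fibreFunctor l U).Fiber (T.baseObj l x.1) := Functor.Fiber.mk (a := V) rfl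
  let s' : (T.L (l + 1)).obj.obj (op ((T.proj l).obj U)) :=
    ((T.L (l + 1)).obj.map (eqToHom x.2).op).hom s
  (Functor.Fiber.fiberInclusion ⋙ fibreOver (T.p l) (T.proj l) x.2).mapAut y
    ((T.band_fibre l hl U).aut y (Multiplicative.ofAdd (T.globalSections l hl U _ hx s')))

/-- A commutative sheaf `L'` (the member `L'₂` of the family of the `L'_l`) which is the group of
automorphisms of the global objects of `F₂` whose images in `F₁` are elements of `L₁`, i.e. are
automorphisms over the identity in `E`. The identification commutes with restrictions, with the
inclusion `ι` of the band `L₂` and with the projection `π` to the band `L₁`. -/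
structure ExtendedBand (hn : 2 ≤ n) where
  L' : Sheaf J AddCommGrpCat.{w}
  ι : T.L 1 ⟶ L'
  π : L' ⟶ T.L 0
  aut : ∀ {X : E} (x : (T.proj 1).Fiber X), T.IsGlobal 0 x.1 →
    (Multiplicative (L'.obj.obj (op X)) ≃* Aut x)
  aut_res : ∀ {X Y : E} (f : X ⟶ Y) (x : (T.proj 1).Fiber Y) (hx : T.IsGlobal 0 x.1)
    (s : L'.obj.obj (op Y)),
    ((T.restr 1).res f).mapAut x (aut x hx (Multiplicative.ofAdd s)) =
      aut (((T.restr 1).res f).obj x) (T.isGlobal_res 0 f x hx)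
        (Multiplicative.ofAdd ((L'.obj.map f.op).hom s))
  aut_ι : ∀ {X : E} (x : (T.proj 1).Fiber X)
    (hx : IsTerminal (T.baseObj 0 x.1))
    (s : (T.L 1).obj.obj (op X)),
    aut x ⟨hx⟩ (Multiplicative.ofAdd ((ι.hom.app (op X)).hom s)) = T.bandAut 0 hn x hx s
  aut_π : ∀ {X : E} (x : (T.proj 1).Fiber X) (hx : T.IsGlobal 0 x.1) (s : L'.obj.obj (op X)),
    (T.down 0 X).mapAut x (aut x hx (Multiplicative.ofAdd s)) =
      T.band_base.aut ((T.down 0 X).obj x) (Multiplicative.ofAdd ((π.hom.app (op X)).hom s))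

end GerbedTower

/-! ### Čech cochains -/

section Cech

variable {E : Type u} [Category.{v} E] [HasFiniteProducts E] {I : Type*} (U : I → E)

/-- The product `U_{i₁…i_m}` of the `U_i` (over the terminal object). -/
noncomputable abbrev inter {m : ℕ} (σ : Fin m → I) : E := ∏ᶜ fun k => U (σ k)

/-- The projection `U_{i₁…i_m} ⟶ U_{i_{f 1}…i_{f k}}`. -/
noncomputable def interMap {m k : ℕ} (σ : Fin m → I) (f : Fin k → Fin m) :
    inter U σ ⟶ inter U (σ ∘ f) :=
  Pi.lift fun a => Pi.π (fun k => U (σ k)) (f a)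

variable {J : GrothendieckTopology E}

/-- Čech cochains of degree `d` with values in `L`. -/
abbrev Cochain (L : Sheaf J AddCommGrpCat.{w}) (d : ℕ) : Type _ :=
  ∀ σ : Fin (d + 1) → I, L.obj.obj (op (inter U σ))

/-- The Čech boundary. -/
noncomputable def boundary (L : Sheaf J AddCommGrpCat.{w}) {d : ℕ} (c : Cochain U L d) :
    Cochain U L (d + 1) :=
  fun σ => ∑ k : Fin (d + 2),
    (-1 : ℤ) ^ (k : ℕ) • (L.obj.map (interMap U σ k.succAbove).op).hom (c (σ ∘ k.succAbove))

/-- A Čech cocycle is a cochain with zero boundary. -/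
def IsCocycle (L : Sheaf J AddCommGrpCat.{w}) {d : ℕ} (c : Cochain U L d) : Prop :=
  boundary U L c = 0

end Cech

/-! ### The classifying cocycles -/

namespace GerbedTower

variable {E : Type u} [Category.{v} E] [HasFiniteProducts E] {J : GrothendieckTopology E} {n : ℕ}
  (T : GerbedTower.{w, v, u, v₁, u₁, v₂, u₂} J n) {I : Type*} (U : I → E)

/-- The restriction to `U_{i₁…i_m}` of the member with index `i_k` of a family of objects
of `F₁`. -/
noncomputable def restrObj (x : ∀ i, (T.proj 0).Fiber (U i)) {m : ℕ} (σ : Fin m → I) (k : Fin m) :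
    (T.proj 0).Fiber (inter U σ) :=
  ((T.restr 0).res (Pi.π (fun k => U (σ k)) k)).obj (x (σ k))

theorem res_restrObj (x : ∀ i, (T.proj 0).Fiber (U i)) {m k : ℕ} (σ : Fin m → I)
    (f : Fin k → Fin m) (a : Fin k) :
    ((T.restr 0).res (interMap U σ f)).obj (T.restrObj U x (σ ∘ f) a) =
      T.restrObj U x σ (f a) := by
  have h : interMap U σ f ≫ Pi.π (fun k => U ((σ ∘ f) k)) a = Pi.π (fun k => U (σ k)) (f a) := by
    simp [interMap]
  have e := (T.restr 0).res_comp (interMap U σ f) (Pi.π (fun k => U ((σ ∘ f) k)) a)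
  rw [h] at e
  exact (Functor.congr_obj e (x (σ (f a)))).symm

/-- Objects `u_i` of `F₁` over the `U_i` and arrows `v_{ij}` over `U_{ij}` from the restriction
of `u_j` to the restriction of `u_i`. -/
structure BaseChoice where
  obj : ∀ i, (T.proj 0).Fiber (U i)
  arrow : ∀ σ : Fin 2 → I, T.restrObj U obj σ 1 ≅ T.restrObj U obj σ 0

variable {T U}

/-- The restriction of `v_{ij}` to `U_{i₁…i_m}`, where `i = i_{f 0}`, `j = i_{f 1}`. -/
noncomputable def BaseChoice.restrArrow (b : T.BaseChoice U) {m : ℕ} (σ : Fin m → I)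
    (f : Fin 2 → Fin m) : T.restrObj U b.obj σ (f 1) ≅ T.restrObj U b.obj σ (f 0) :=
  eqToIso (T.res_restrObj U b.obj σ f 1).symm ≪≫
    ((T.restr 0).res (interMap U σ f)).mapIso (b.arrow (σ ∘ f)) ≪≫
      eqToIso (T.res_restrObj U b.obj σ f 0)

/-- The classifying cocycle `c_{i₁i₂i₃} = (v_{i₁i₃})⁻¹ v_{i₁i₂} v_{i₂i₃}` of the gerbe `F₁ ⟶ E`, an
automorphism of the restriction of `u_{i₃}` to `U_{i₁i₂i₃}`. -/
noncomputable def BaseChoice.classifying (b : T.BaseChoice U) (σ : Fin 3 → I) :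
    Aut (T.restrObj U b.obj σ 2) :=
  b.restrArrow σ ![1, 2] ≪≫ b.restrArrow σ ![0, 1] ≪≫ (b.restrArrow σ ![0, 2]).symm

/-- Global objects `u_{i₁i₂i₃}` of `F₂` over the restriction of `u_{i₃}` to `U_{i₁i₂i₃}`, and lifts
`(c_{i₁i₂i₃})^*` of the `c_{i₁i₂i₃}` to automorphisms of the `u_{i₁i₂i₃}`. -/
structure LiftChoice (b : T.BaseChoice U) where
  obj : ∀ σ : Fin 3 → I, (T.p 0).Fiber (T.restrObj U b.obj σ 2).1
  isGlobal : ∀ σ, T.IsGlobal 0 (obj σ).1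
  lift : ∀ σ, Aut ((fibreOver (T.p 0) (T.proj 0) (T.restrObj U b.obj σ 2).2).obj (obj σ))
  isLift : ∀ σ, (T.p 0).IsHomLift (b.classifying σ).hom.1 (lift σ).hom.1

/-- The object `u_{i₁i₂i₃}`, as an object over `U_{i₁i₂i₃}`. -/
noncomputable def LiftChoice.objOver {b : T.BaseChoice U} (c : LiftChoice b) (σ : Fin 3 → I) :
    (T.proj 1).Fiber (inter U σ) :=
  (fibreOver (T.p 0) (T.proj 0) (T.restrObj U b.obj σ 2).2).obj (c.obj σ)

/-- The restriction to `U_{i₁i₂i₃i₄}` of the object `u` whose indices are `i₁,…,i₄` without the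
index at place `k`. -/
noncomputable def LiftChoice.restrObj {b : T.BaseChoice U} (c : LiftChoice b) (σ : Fin 4 → I)
    (k : Fin 4) : (T.proj 1).Fiber (inter U σ) :=
  ((T.restr 1).res (interMap U σ k.succAbove)).obj (c.objOver (σ ∘ k.succAbove))

/-- The restriction to `U_{i₁i₂i₃i₄}` of the lift `c^*` whose indices are `i₁,…,i₄` without the
index at place `k`. -/
noncomputable def LiftChoice.restrLift {b : T.BaseChoice U} (c : LiftChoice b) (σ : Fin 4 → I)
    (k : Fin 4) : Aut (c.restrObj σ k) :=
  ((T.restr 1).res (interMap U σ k.succAbove)).mapAut (c.objOver (σ ∘ k.succAbove))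
    (c.lift (σ ∘ k.succAbove))

theorem LiftChoice.isGlobal_restrObj {b : T.BaseChoice U} (c : LiftChoice b) (σ : Fin 4 → I)
    (k : Fin 4) : T.IsGlobal 0 (c.restrObj σ k).1 :=
  T.isGlobal_res 0 _ _ (c.isGlobal (σ ∘ k.succAbove))

/-- The alternating sum of the restrictions of the lifts, in the group `L'₂(U_{i₁i₂i₃i₄})`
with which the automorphism groups of all four objects are identified:
`c_{i₂i₃i₄}^* - c_{i₁i₃i₄}^* + c_{i₁i₂i₄}^* - c_{i₁i₂i₃}^*`. -/
noncomputable def LiftChoice.altSum {hn : 2 ≤ n} (X : T.ExtendedBand hn) {b : T.BaseChoice U}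
    (c : LiftChoice b) (σ : Fin 4 → I) : X.L'.obj.obj (op (inter U σ)) :=
  ∑ k : Fin 4, (-1 : ℤ) ^ (k : ℕ) •
    ((X.aut (c.restrObj σ k) (c.isGlobal_restrObj σ k)).symm (c.restrLift σ k)).toAdd

/-- The automorphism `c_{i₁i₂i₃i₄}` of the restriction of `u_{i₁i₂i₃}` to `U_{i₁i₂i₃i₄}`. -/
noncomputable def LiftChoice.higher {hn : 2 ≤ n} (X : T.ExtendedBand hn) {b : T.BaseChoice U}
    (c : LiftChoice b) (σ : Fin 4 → I) : Aut (c.restrObj σ 3) :=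
  X.aut (c.restrObj σ 3) (c.isGlobal_restrObj σ 3) (Multiplicative.ofAdd (c.altSum X σ))

/-- The cochain `s` with values in `L₂` consists of the automorphisms `c_{i₁i₂i₃i₄}`: the section
`s_{i₁i₂i₃i₄}` of the band acts on the restriction of `u_{i₁i₂i₃}` as `c_{i₁i₂i₃i₄}`. -/
def LiftChoice.IsClassifying {hn : 2 ≤ n} (X : T.ExtendedBand hn) {b : T.BaseChoice U}
    (c : LiftChoice b) (s : Cochain U (T.L 1) 3) : Prop :=
  ∀ (σ : Fin 4 → I) (h : IsTerminal (T.baseObj 0 (c.restrObj σ 3).1)),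
    T.bandAut 0 hn (c.restrObj σ 3) h (s σ) = c.higher X σ

end GerbedTower

end GerbeTheory

namespace GerbeTheory

/-! ### Čech complexes: restriction of cochains and the square of the boundary. -/

section Cech

variable {E : Type u} [Category.{v} E] [HasFiniteProducts E] {I : Type*} (U : I → E)
  {J : GrothendieckTopology E}

/-! For the existence of lifts (`exists_aut_lift`), the classifying automorphism lifts to a 2-arrow
into the given global object `V`. Its source is again global, since inverse images preserve terminal
objects, so it is isomorphic to `V` by assumption. Composing gives an automorphism of `V`.

For the cocycle, read the lifts as a Čech 2-cochain γ with values in `L₂'`. The identifications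
commute with restriction, so the alternating sum is the boundary ∂γ (`altSum_eq_boundary`). The
image of γ in `L₁` is the classifying cochain of `F₁` (`π_cochain`), whose boundary vanishes by the
tetrahedron relation (`boundary_cocycle`). Hence ∂γ acts trivially in `F₁`, and on a global object
such an automorphism comes from the band `L₂` (`exists_bandAut_eq`). This yields s with ι(s) = ∂γ.
Over any `X` carrying a global object ι is injective (`ι_injective`), so s is unique, and ι(∂s) =
∂∂γ = 0 (`boundary_boundary`) forces ∂s = 0. -/

theorem interMap_comp {m k l : ℕ} (σ : Fin m → I) (f : Fin k → Fin m) (g : Fin l → Fin k) :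
    interMap U σ f ≫ interMap U (σ ∘ f) g = interMap U σ (f ∘ g) := by
  refine Pi.hom_ext _ _ fun a => ?_
  simp only [interMap, Category.assoc]
  erw [Pi.lift_π, Pi.lift_π, Pi.lift_π]
  rfl

/-- The restriction to `U_{i₁…i_m}` of the section `c` on `U_{i_{f 1}…i_{f k}}`. -/
noncomputable def restrCochain (L : Sheaf J AddCommGrpCat.{w}) {d m : ℕ} (c : Cochain U L d)
    (σ : Fin m → I) (f : Fin (d + 1) → Fin m) : L.obj.obj (op (inter U σ)) :=
  (L.obj.map (interMap U σ f).op).hom (c (σ ∘ f))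

theorem map_restrCochain (L : Sheaf J AddCommGrpCat.{w}) {d m k : ℕ} (c : Cochain U L d)
    (σ : Fin m → I) (f : Fin k → Fin m) (g : Fin (d + 1) → Fin k) :
    (L.obj.map (interMap U σ f).op).hom (restrCochain U L c (σ ∘ f) g) =
      restrCochain U L c σ (f ∘ g) := by
  have h := congrArg Quiver.Hom.op (interMap_comp U σ f g)
  rw [op_comp] at h
  unfold restrCochain
  change _ = (L.obj.map (interMap U σ (f ∘ g)).op).hom (c ((σ ∘ f) ∘ g))
  rw [← h, L.obj.map_comp]
  rfl

theorem boundary_apply (L : Sheaf J AddCommGrpCat.{w}) {d : ℕ} (c : Cochain U L d)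
    (σ : Fin (d + 2) → I) :
    boundary U L c σ =
      ∑ k : Fin (d + 2), (-1 : ℤ) ^ (k : ℕ) • restrCochain U L c σ k.succAbove := rfl

theorem boundary_boundary (L : Sheaf J AddCommGrpCat.{w}) {d : ℕ} (c : Cochain U L d) :
    boundary U L (boundary U L c) = 0 := by
  funext σ
  have h : boundary U L (boundary U L c) σ = ∑ a : Fin (d + 3) × Fin (d + 2),
      (-1 : ℤ) ^ ((a.1 : ℕ) + (a.2 : ℕ)) •
        restrCochain U L c σ (a.1.succAbove ∘ a.2.succAbove) := by
    rw [boundary_apply, Fintype.sum_prod_type]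
    refine Finset.sum_congr rfl fun k _ => ?_
    rw [restrCochain, boundary_apply, map_sum, Finset.smul_sum]
    refine Finset.sum_congr rfl fun j _ => ?_
    rw [map_zsmul, map_restrCochain, smul_smul, pow_add]
  rw [h]
  -- The involution exchanges the order in which the same two indices are deleted: the face is
  -- unchanged, the sign flips, and the first deleted index differs, so there is no fixed point.
  refine Finset.sum_involution (fun a _ => (a.1.succAbove a.2, a.2.predAbove a.1)) ?_ ?_
    (fun _ _ => Finset.mem_univ _) ?_
  · rintro ⟨i, j⟩ -
    have e : (i.succAbove j).succAbove ∘ (j.predAbove i).succAbove =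
        i.succAbove ∘ j.succAbove := funext fun a =>
      Fin.succAbove_succAbove_succAbove_predAbove i j a
    simp only [e]
    rw [Fin.neg_one_pow_succAbove_add_predAbove, neg_smul, add_neg_cancel]
  · rintro ⟨i, j⟩ - - e
    exact Fin.succAbove_ne i j (Prod.ext_iff.1 e).1
  · rintro ⟨i, j⟩ -
    simp [Fin.succAbove_succAbove_predAbove, Fin.predAbove_predAbove_succAbove]

theorem restrCochain_naturality {L L' : Sheaf J AddCommGrpCat.{w}} (φ : L ⟶ L') {d m : ℕ}
    (c : Cochain U L d) (σ : Fin m → I) (f : Fin (d + 1) → Fin m) :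
    (φ.hom.app _).hom (restrCochain U L c σ f) =
      restrCochain U L' (fun τ => (φ.hom.app _).hom (c τ)) σ f := by
  have h := φ.hom.naturality (interMap U σ f).op
  exact ConcreteCategory.congr_hom h (c (σ ∘ f))

theorem boundary_naturality {L L' : Sheaf J AddCommGrpCat.{w}} (φ : L ⟶ L') {d : ℕ}
    (c : Cochain U L d) (σ : Fin (d + 2) → I) :
    (φ.hom.app _).hom (boundary U L c σ) =
      boundary U L' (fun τ => (φ.hom.app _).hom (c τ)) σ := by
  simp only [boundary_apply, map_sum, map_zsmul, restrCochain_naturality]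

end Cech

/-! ### Calculus of band actions in a fibre. -/

namespace Banding

variable {𝒢 : Type u₁} [Category.{v₁} 𝒢] {C : Type u₂} [Category.{v₂} C] {p : 𝒢 ⥤ C}
  {J : GrothendieckTopology C} {L : Sheaf J AddCommGrpCat.{w}}

theorem aut_naturality (B : Banding p L) {X : C} {x y : p.Fiber X} (φ : x ⟶ y)
    (s : L.obj.obj (op X)) :
    (B.aut x (Multiplicative.ofAdd s)).hom ≫ φ = φ ≫ (B.aut y (Multiplicative.ofAdd s)).hom := by
  have h := B.natural (𝟙 X) x y φ.1 φ.2 s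
  rw [op_id, L.obj.map_id] at h
  exact Subtype.ext h

theorem aut_hom_comp (B : Banding p L) {X : C} (x : p.Fiber X) (s t : L.obj.obj (op X)) :
    (B.aut x (Multiplicative.ofAdd s)).hom ≫ (B.aut x (Multiplicative.ofAdd t)).hom =
      (B.aut x (Multiplicative.ofAdd (s + t))).hom := by
  -- Multiplication in `Aut` is composition in the reverse order, hence the swap.
  rw [add_comm s t, ofAdd_add, map_mul]
  rfl

/-- The cocycle relation for the defects of commutativity of the faces of a tetrahedron. -/
theorem add_eq_add_of_faces (B : Banding p L) {X : C} {x₀ x₁ x₂ x₃ : p.Fiber X}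
    {e₀₁ : x₁ ⟶ x₀} {e₀₂ : x₂ ⟶ x₀} {e₀₃ : x₃ ⟶ x₀} {e₁₂ : x₂ ⟶ x₁} {e₁₃ : x₃ ⟶ x₁}
    {e₂₃ : x₃ ⟶ x₂} [Mono e₀₃] {s₀ s₁ s₂ s₃ : L.obj.obj (op X)}
    (h₀ : e₂₃ ≫ e₁₂ = (B.aut x₃ (Multiplicative.ofAdd s₀)).hom ≫ e₁₃)
    (h₁ : e₂₃ ≫ e₀₂ = (B.aut x₃ (Multiplicative.ofAdd s₁)).hom ≫ e₀₃)
    (h₂ : e₁₃ ≫ e₀₁ = (B.aut x₃ (Multiplicative.ofAdd s₂)).hom ≫ e₀₃)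
    (h₃ : e₁₂ ≫ e₀₁ = (B.aut x₂ (Multiplicative.ofAdd s₃)).hom ≫ e₀₂) :
    s₀ + s₂ = s₃ + s₁ := by
  -- After composition with `e₀₃` both sides become `e₂₃ ≫ e₁₂ ≫ e₀₁`. The defect `s₃` acts on `x₂`
  -- and is carried to `x₃` along `e₂₃` by naturality.
  refine Multiplicative.ofAdd.injective ((B.aut x₃).injective
    (Iso.ext ((cancel_mono e₀₃).1 ?_)))
  rw [← aut_hom_comp, ← aut_hom_comp, Category.assoc, Category.assoc, ← h₂, ← h₁,
    reassoc_of% (B.aut_naturality e₂₃ s₃), ← h₃, ← reassoc_of% h₀]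

/-- In a category fibered in groupoids `a` is cartesian, so a vertical endomorphism of `x` is
determined by its composite with `a`. -/
theorem hom_eq_of_comp_eq (B : Banding p L) (hp : IsFiberedInGroupoids p) {X Y : C} (f : X ⟶ Y)
    {x : p.Fiber X} {y : p.Fiber Y} (a : x.1 ⟶ y.1) (ha : p.IsHomLift f a)
    (s : L.obj.obj (op Y)) (φ : x ⟶ x)
    (h : φ.1 ≫ a = a ≫ (B.aut y (Multiplicative.ofAdd s)).hom.1) :
    φ = (B.aut x (Multiplicative.ofAdd ((L.obj.map f.op).hom s))).hom := by
  have hc : p.IsStronglyCartesian f a := by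
    have := hp.cartesian a
    obtain ⟨x, rfl⟩ := x
    obtain ⟨y, rfl⟩ := y
    rwa [IsHomLift.eq_of_isHomLift p f a]
  have h₁ := φ.2
  have h₂ := (B.aut x (Multiplicative.ofAdd ((L.obj.map f.op).hom s))).hom.2
  exact Subtype.ext (Functor.IsStronglyCartesian.ext p f a (𝟙 X)
    (h.trans (B.natural f x y a ha s).symm))

end Banding

/-! ### The classifying 2-cocycle of `F₁ ⟶ E`. -/

namespace GerbedTower

section

variable {E : Type u} [Category.{v} E] {J : GrothendieckTopology E} {n : ℕ}
  (T : GerbedTower.{w, v, u, v₁, u₁, v₂, u₂} J n)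

/-- The band of the gerbe `F₁ ⟶ E`. -/
def projBanding : Banding (T.proj 0) (T.L 0) := T.band_base

theorem isFiberedInGroupoids_proj : IsFiberedInGroupoids (T.proj 0) := T.gerbe_base.fibered

/-- For `L₂'` the analogous compatibility is part of the data. For `L₁` it follows from naturality
of the arrows from restrictions to the original objects, which are cartesian. -/
theorem res_map_projBanding {X Y : E} (f : X ⟶ Y) (x : (T.proj 0).Fiber Y)
    (s : (T.L 0).obj.obj (op Y)) :
    ((T.restr 0).res f).map (T.projBanding.aut x (Multiplicative.ofAdd s)).hom =
      (T.projBanding.aut (((T.restr 0).res f).obj x)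
        (Multiplicative.ofAdd (((T.L 0).obj.map f.op).hom s))).hom :=
  T.projBanding.hom_eq_of_comp_eq T.isFiberedInGroupoids_proj f (((T.restr 0).arr f).app x)
    ((T.restr 0).arr_lift f x) s _
    (((T.restr 0).arr f).naturality (T.projBanding.aut x (Multiplicative.ofAdd s)).hom)

end

variable {E : Type u} [Category.{v} E] [HasFiniteProducts E] {J : GrothendieckTopology E} {n : ℕ}
  {T : GerbedTower.{w, v, u, v₁, u₁, v₂, u₂} J n} {I : Type*} {U : I → E}

namespace BaseChoice

/-- The restriction of `v_{ij}` to `U_{i₁…i_m}`, where `i` and `j` have the places `a` and `b`. -/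
noncomputable def edge (b : T.BaseChoice U) {m : ℕ} (σ : Fin m → I) (i j : Fin m) :
    T.restrObj U b.obj σ j ≅ T.restrObj U b.obj σ i :=
  b.restrArrow σ ![i, j]

theorem restrArrow_hom_congr (b : T.BaseChoice U) {m : ℕ} (σ : Fin m → I) {f g : Fin 2 → Fin m}
    (h : f = g) :
    (b.restrArrow σ f).hom = eqToHom (by rw [h]) ≫ (b.restrArrow σ g).hom ≫
      eqToHom (by rw [h]) := by
  subst h
  simp

/-- Strictness of the restriction functors makes iterated restriction agree with direct restriction.
The `eqToHom`s only record equalities of objects. -/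
theorem res_map_restrArrow (b : T.BaseChoice U) {m k : ℕ} (σ : Fin m → I) (f : Fin k → Fin m)
    (g : Fin 2 → Fin k) :
    ((T.restr 0).res (interMap U σ f)).map (b.restrArrow (σ ∘ f) g).hom =
      eqToHom (T.res_restrObj U b.obj σ f (g 1)) ≫ (b.restrArrow σ (f ∘ g)).hom ≫
        eqToHom (T.res_restrObj U b.obj σ f (g 0)).symm := by
  have h := Functor.congr_hom (by rw [← interMap_comp, (T.restr 0).res_comp] :
    (T.restr 0).res (interMap U σ (f ∘ g)) =
      (T.restr 0).res (interMap U (σ ∘ f) g) ⋙ (T.restr 0).res (interMap U σ f))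
      (b.arrow (σ ∘ f ∘ g)).hom
  have h' : (b.restrArrow σ (f ∘ g)).hom =
      eqToHom (T.res_restrObj U b.obj σ (f ∘ g) 1).symm ≫
        ((T.restr 0).res (interMap U σ (f ∘ g))).map (b.arrow (σ ∘ f ∘ g)).hom ≫
          eqToHom (T.res_restrObj U b.obj σ (f ∘ g) 0) := rfl
  have h'' : (b.restrArrow (σ ∘ f) g).hom =
      eqToHom (T.res_restrObj U b.obj (σ ∘ f) g 1).symm ≫
        ((T.restr 0).res (interMap U (σ ∘ f) g)).map (b.arrow (σ ∘ f ∘ g)).hom ≫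
          eqToHom (T.res_restrObj U b.obj (σ ∘ f) g 0) := rfl
  rw [h', h, h'', Functor.map_comp, Functor.map_comp, eqToHom_map, eqToHom_map]
  simp only [Functor.comp_map, Category.assoc]
  erw [eqToHom_trans_assoc, eqToHom_trans_assoc, eqToHom_trans, eqToHom_trans]

theorem res_map_edge (b : T.BaseChoice U) {m k : ℕ} (σ : Fin m → I) (f : Fin k → Fin m)
    (i j : Fin k) :
    ((T.restr 0).res (interMap U σ f)).map (b.edge (σ ∘ f) i j).hom =
      eqToHom (T.res_restrObj U b.obj σ f j) ≫ (b.edge σ (f i) (f j)).hom ≫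
        eqToHom (T.res_restrObj U b.obj σ f i).symm := by
  have e : ![f i, f j] = f ∘ ![i, j] := by
    ext a; fin_cases a <;> rfl
  have h : (b.edge σ (f i) (f j)).hom = (b.restrArrow σ (f ∘ ![i, j])).hom :=
    -- The end objects agree definitionally, so both transports reduce to identities.
    (b.restrArrow_hom_congr σ e).trans ((Category.id_comp _).trans (Category.comp_id _))
  rw [h]
  exact b.res_map_restrArrow σ f ![i, j]

/-- The section of the band `L₁` which acts as the classifying cocycle. -/
noncomputable def cocycle (b : T.BaseChoice U) : Cochain U (T.L 0) 2 :=
  fun σ => ((T.projBanding.aut (T.restrObj U b.obj σ 2)).symm (b.classifying σ)).toAdd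

theorem aut_cocycle (b : T.BaseChoice U) (σ : Fin 3 → I) :
    T.projBanding.aut (T.restrObj U b.obj σ 2) (Multiplicative.ofAdd (b.cocycle σ)) =
      b.classifying σ :=
  (T.projBanding.aut (T.restrObj U b.obj σ 2)).apply_symm_apply _

theorem classifying_hom_comp (b : T.BaseChoice U) (σ : Fin 3 → I) :
    (b.classifying σ).hom ≫ (b.edge σ 0 2).hom = (b.edge σ 1 2).hom ≫ (b.edge σ 0 1).hom := by
  have h : (b.classifying σ).hom =
      (b.edge σ 1 2).hom ≫ (b.edge σ 0 1).hom ≫ (b.edge σ 0 2).inv := rfl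
  rw [h, Category.assoc, Category.assoc, Iso.inv_hom_id, Category.comp_id]

/-- The classifying cochain measures the failure of the triangle of the `v`'s to commute;
restriction transports this to every triple of indices. -/
theorem edge_comp_edge (b : T.BaseChoice U) {m : ℕ} (σ : Fin m → I) (f : Fin 3 → Fin m) :
    (b.edge σ (f 1) (f 2)).hom ≫ (b.edge σ (f 0) (f 1)).hom =
      (T.projBanding.aut (T.restrObj U b.obj σ (f 2))
        (Multiplicative.ofAdd (restrCochain U (T.L 0) b.cocycle σ f))).hom ≫
      (b.edge σ (f 0) (f 2)).hom := by
  have h := congrArg ((T.restr 0).res (interMap U σ f)).map (b.classifying_hom_comp (σ ∘ f))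
  have h₁ := T.projBanding.aut_naturality (X := inter U σ)
    (eqToHom (T.res_restrObj U b.obj σ f 2)) (restrCochain U (T.L 0) b.cocycle σ f)
  rw [← aut_cocycle, Functor.map_comp, Functor.map_comp, res_map_projBanding, res_map_edge,
    res_map_edge, res_map_edge] at h
  change (T.projBanding.aut _ (Multiplicative.ofAdd
    (restrCochain U (T.L 0) b.cocycle σ f))).hom ≫ _ = _ at h
  rw [reassoc_of% h₁] at h
  simp only [Category.assoc, eqToHom_trans_assoc, eqToHom_refl, Category.id_comp] at h
  rw [← cancel_mono (eqToHom (T.res_restrObj U b.obj σ f 0).symm),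
    ← cancel_epi (eqToHom (T.res_restrObj U b.obj σ f 2))]
  simpa only [Category.assoc] using h.symm

/-- The four terms are the defects of the faces of the tetrahedron whose edges are the six
restricted `v`'s. -/
theorem boundary_cocycle (b : T.BaseChoice U) : boundary U (T.L 0) b.cocycle = 0 := by
  funext (σ : Fin 4 → I)
  have h := T.projBanding.add_eq_add_of_faces (X := inter U σ)
    (e₀₁ := (b.edge σ 0 1).hom) (e₀₂ := (b.edge σ 0 2).hom) (e₀₃ := (b.edge σ 0 3).hom)
    (e₁₂ := (b.edge σ 1 2).hom) (e₁₃ := (b.edge σ 1 3).hom) (e₂₃ := (b.edge σ 2 3).hom)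
    (b.edge_comp_edge σ (Fin.succAbove 0)) (b.edge_comp_edge σ (Fin.succAbove 1))
    (b.edge_comp_edge σ (Fin.succAbove 2)) (b.edge_comp_edge σ (Fin.succAbove 3))
  rw [boundary_apply, Fin.sum_univ_four]
  have e : (-1 : ℤ) ^ ((3 : Fin 4) : ℕ) = -1 := rfl
  simp only [Fin.val_zero, Fin.val_one, Fin.val_two, e, pow_zero, pow_one, one_smul, neg_smul,
    even_two, Even.neg_pow, one_pow]
  rw [eq_sub_of_add_eq h]
  change _ = (0 : (T.L 0).obj.obj (op (inter U σ)))
  abel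

end BaseChoice

end GerbedTower

/-! ### Isomorphisms and faithfulness in fibres. -/

section Fibres

variable {𝒜 : Type u₁} [Category.{v₁} 𝒜] {𝒞 : Type u₂} [Category.{v₂} 𝒞]
  {𝒮 : Type u₃} [Category.{v₃} 𝒮]

theorem isHomLift_comp_functor (p : 𝒜 ⥤ 𝒞) (r : 𝒞 ⥤ 𝒮) {a b : 𝒜} {c d : 𝒞} {X Y : 𝒮}
    (g : X ⟶ Y) (f : c ⟶ d) (φ : a ⟶ b) (hφ : p.IsHomLift f φ) (hf : r.IsHomLift g f) :
    (p ⋙ r).IsHomLift g φ := by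
  subst_hom_lift p f φ
  subst_hom_lift r g (p.map φ)
  exact IsHomLift.map (p ⋙ r) φ

/-- An isomorphism over an identity, as an isomorphism of the fibre. -/
def fibreIso {p : 𝒜 ⥤ 𝒞} {X : 𝒞} {x y : p.Fiber X} (e : x.1 ≅ y.1)
    (h : p.IsHomLift (𝟙 X) e.hom) : x ≅ y where
  hom := ⟨e.hom, h⟩
  inv := ⟨e.inv, inferInstance⟩
  hom_inv_id := Subtype.ext e.hom_inv_id
  inv_hom_id := Subtype.ext e.inv_hom_id

theorem eqToHom_fibre_val {p : 𝒜 ⥤ 𝒞} {X : 𝒞} {x y : p.Fiber X} (h : x = y) :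
    (eqToHom h).1 = eqToHom (congrArg Subtype.val h) := by
  subst h
  rfl

theorem isIso_fibreHom {p : 𝒜 ⥤ 𝒞} {X : 𝒞} {x y : p.Fiber X} (e : x ≅ y) : IsIso e.hom.1 :=
  (Functor.Fiber.fiberInclusion.mapIso e).isIso_hom

theorem faithful_fibreOver (p : 𝒜 ⥤ 𝒞) (r : 𝒞 ⥤ 𝒮) {X : 𝒮} {U : 𝒞} (hU : r.obj U = X) :
    (fibreOver p r hU).Faithful where
  map_injective {_ _ φ ψ} h := Subtype.ext (congrArg (fun χ => χ.1) h : φ.1 = ψ.1)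

end Fibres

theorem mapAut_injective {𝒜 : Type u₁} [Category.{v₁} 𝒜] {𝒞 : Type u₂} [Category.{v₂} 𝒞]
    (F : 𝒜 ⥤ 𝒞) [F.Faithful] (x : 𝒜) : Function.Injective (F.mapAut x) :=
  fun _ _ h => Iso.ext (F.map_injective (congrArg Iso.hom h))

/-! ### Lifting automorphisms, and the band action on global objects. -/

namespace GerbedTower

section

variable {E : Type u} [Category.{v} E] {J : GrothendieckTopology E} {n : ℕ}
  (T : GerbedTower.{w, v, u, v₁, u₁, v₂, u₂} J n)

theorem isGlobal_of_isCartesian (l : ℕ) {V V' : T.F (l + 1)} (φ : V ⟶ V')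
    (h : (T.t l).IsCartesian ((T.p l).map φ) ((T.q l).map φ)) (hV' : T.IsGlobal l V') :
    T.IsGlobal l V :=
  (T.topos l).terminal _ (T.baseObj l V) (T.baseObj l V') _ h hV'

theorem isGlobal_lift (l : ℕ) {U₁ U₂ : T.F l} (f : U₁ ⟶ U₂) (V₁ : (T.p l).Fiber U₁)
    (V₂ : (T.p l).Fiber U₂) (φ : V₁.1 ⟶ V₂.1) (hφ : (T.p l).IsHomLift f φ)
    (h : (T.t l).IsCartesian f ((T.q l).map φ)) (hV₂ : T.IsGlobal l V₂.1) :
    T.IsGlobal l V₁.1 := by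
  obtain ⟨V₁, rfl⟩ := V₁
  obtain ⟨V₂, rfl⟩ := V₂
  refine T.isGlobal_of_isCartesian l φ ?_ hV₂
  rwa [← IsHomLift.eq_of_isHomLift (T.p l) f φ]

/-- A `2`-arrow over an isomorphism of `F l` is invertible if its `1`-arrow is cartesian. -/
theorem isIso_lift (l : ℕ) {U₁ U₂ : T.F l} (f : U₁ ⟶ U₂) [IsIso f] {V₁ V₂ : T.F (l + 1)}
    (φ : V₁ ⟶ V₂) (h : (T.t l).IsCartesian f ((T.q l).map φ)) : IsIso φ := by
  refine T.isIso_of_isIso l φ ?_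
  have := (T.topos l).fibered
  have : (T.t l).IsStronglyCartesian f ((T.q l).map φ) := inferInstance
  exact Functor.IsStronglyCartesian.isIso_of_base_isIso (T.t l) f _

/-- An automorphism of `u` lifts to a global object over `u` which is isomorphic to all the
global objects over `u`. -/
theorem exists_aut_lift (l : ℕ) {X : E} (u : (T.proj l).Fiber X) (c : Aut u)
    (V : (T.p l).Fiber u.1) (hV : T.IsGlobal l V.1)
    (huniq : ∀ V' : (T.p l).Fiber u.1, T.IsGlobal l V'.1 → Nonempty (V ≅ V')) :
    ∃ c' : Aut ((fibreOver (T.p l) (T.proj l) u.2).obj V), (T.p l).IsHomLift c.hom.1 c'.hom.1 := by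
  obtain ⟨V₁, φ, hφ, hq⟩ := T.exists_lift l c.hom.1 V
  -- The lifted arrow need not start at `V`; `e` lies over the identity, so precomposing with it
  -- corrects the source without changing the image.
  obtain ⟨e⟩ := huniq V₁ (T.isGlobal_lift l _ V₁ V φ hφ hq hV)
  have := isIso_fibreHom c
  have hφ' : IsIso φ := T.isIso_lift l c.hom.1 φ hq
  have he := e.hom.2
  have hψ : (T.p l).IsHomLift c.hom.1 (e.hom.1 ≫ φ) := inferInstance
  exact ⟨fibreIso (p := T.p l ⋙ T.proj l)
    (x := (fibreOver (T.p l) (T.proj l) u.2).obj V) (y := (fibreOver (T.p l) (T.proj l) u.2).obj V)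
    (Functor.Fiber.fiberInclusion.mapIso e ≪≫ @asIso _ _ _ _ φ hφ') (isHomLift_comp_functor _ _ _ _ _ hψ c.hom.2), hψ⟩

theorem bandAut_injective (l : ℕ) (hl : l + 1 < n) {X : E} (x : (T.proj (l + 1)).Fiber X)
    (hx : IsTerminal (T.baseObj l x.1)) : Function.Injective (T.bandAut l hl x hx) := by
  intro s t h
  have : (Functor.Fiber.fiberInclusion (p := T.fibreFunctor l _) (S := T.baseObj l x.1) ⋙
      fibreOver (T.p l) (T.proj l) x.2).Faithful := @Functor.Faithful.comp _ _ _ _ _ _ _ _ _ (faithful_fibreOver _ _ _)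
  have h₁ := Multiplicative.ofAdd.injective
    (((T.band_fibre l hl _).aut _).injective (mapAut_injective _ _ h))
  have h₂ := (T.globalSections l hl _ _ hx).injective h₁
  exact (ConcreteCategory.bijective_of_isIso
    ((T.L (l + 1)).obj.map (eqToHom x.2).op)).1 h₂

/-- This is the exactness that replaces a hypothesis on the sheaf maps: an automorphism trivial one
level down is vertical in the fibre gerbe, so a global section of its band induces it. -/
theorem exists_bandAut_eq (l : ℕ) (hl : l + 1 < n) {X : E} (x : (T.proj (l + 1)).Fiber X)
    (hx : IsTerminal (T.baseObj l x.1)) (a : Aut x) (ha : (T.down l X).mapAut x a = 1) :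
    ∃ s, T.bandAut l hl x hx s = a := by
  have hp : (T.p l).map a.hom.1 = 𝟙 _ := congrArg (fun b => b.hom.1) ha
  have h₁ : (T.p l).IsHomLift (𝟙 ((T.p l).obj x.1)) a.hom.1 := by
    rw [← hp]
    infer_instance
  let V : (T.p l).Fiber ((T.p l).obj x.1) := Functor.Fiber.mk (a := x.1) rfl
  let α : V ≅ V := fibreIso (p := T.p l) (x := V) (y := V)
    (Functor.Fiber.fiberInclusion.mapIso a) h₁
  -- Globality enters here: a terminal object has no endomorphism but the identity.
  have h₂ : (T.fibreFunctor l _).map α.hom = 𝟙 (T.baseObj l x.1) := hx.hom_ext _ _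
  have h₃ : (T.fibreFunctor l _).IsHomLift (𝟙 (T.baseObj l x.1)) α.hom := by
    rw [← h₂]
    exact IsHomLift.map (T.fibreFunctor l _) α.hom
  let y : (T.fibreFunctor l _).Fiber (T.baseObj l x.1) := Functor.Fiber.mk (a := V) rfl
  let β : Aut y := fibreIso (p := T.fibreFunctor l _) (x := y) (y := y) α h₃
  obtain ⟨s', hs'⟩ := ((T.band_fibre l hl _).aut y).surjective β
  obtain ⟨s, hs⟩ := (T.globalSections l hl _ _ hx).surjective s'.toAdd
  obtain ⟨r, hr⟩ := (ConcreteCategory.bijective_of_isIso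
    ((T.L (l + 1)).obj.map (eqToHom x.2).op)).2 s
  refine ⟨r, ?_⟩
  have e : (T.band_fibre l hl _).aut y (Multiplicative.ofAdd (T.globalSections l hl _ _ hx
      (((T.L (l + 1)).obj.map (eqToHom x.2).op).hom r))) = β := by
    rw [← hs']
    congr 1
    refine Multiplicative.toAdd.injective ?_
    exact (congrArg (T.globalSections l hl _ _ hx) hr).trans hs
  have e' := congrArg ((Functor.Fiber.fiberInclusion ⋙
    fibreOver (T.p l) (T.proj l) x.2).mapAut y) e
  exact e'.trans (Iso.ext rfl)

variable {T} in
-- The map ι is not assumed mono; injectivity over `X` comes from the faithful action of the band on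
-- a global object.
theorem ExtendedBand.ι_injective {hn : 2 ≤ n} (Y : T.ExtendedBand hn) {X : E}
    (x : (T.proj 1).Fiber X) (hx : T.IsGlobal 0 x.1) :
    Function.Injective (Y.ι.hom.app (op X)).hom := by
  intro s t h
  obtain ⟨hx⟩ := hx
  refine T.bandAut_injective 0 hn x hx ?_
  rw [← Y.aut_ι, ← Y.aut_ι, h]

end

variable {E : Type u} [Category.{v} E] [HasFiniteProducts E] {J : GrothendieckTopology E} {n : ℕ}
  {T : GerbedTower.{w, v, u, v₁, u₁, v₂, u₂} J n} {I : Type*} {U : I → E}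

/-! ### The lifted cochain and the degree 3 cocycle. -/

namespace LiftChoice

theorem nonempty (b : T.BaseChoice U)
    (h : ∀ σ : Fin 3 → I,
      (∃ V : (T.p 0).Fiber (T.restrObj U b.obj σ 2).1, T.IsGlobal 0 V.1) ∧
      ∀ V V' : (T.p 0).Fiber (T.restrObj U b.obj σ 2).1,
        T.IsGlobal 0 V.1 → T.IsGlobal 0 V'.1 → Nonempty (V ≅ V')) :
    Nonempty (LiftChoice b) := by
  choose V hV using fun σ => (h σ).1
  choose c hc using fun σ => T.exists_aut_lift 0 (T.restrObj U b.obj σ 2) (b.classifying σ) (V σ)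
    (hV σ) fun V' hV' => (h σ).2 _ _ (hV σ) hV'
  exact ⟨⟨V, hV, c, hc⟩⟩

variable {hn : 2 ≤ n} (X : T.ExtendedBand hn) {b : T.BaseChoice U} (c : LiftChoice b)

/-- The lifts of the classifying cocycle, as sections of `L₂'`. -/
noncomputable def cochain : Cochain U X.L' 2 :=
  fun σ => ((X.aut (c.objOver σ) (c.isGlobal σ)).symm (c.lift σ)).toAdd

theorem aut_cochain (σ : Fin 3 → I) :
    X.aut (c.objOver σ) (c.isGlobal σ) (Multiplicative.ofAdd (c.cochain X σ)) = c.lift σ :=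
  (X.aut (c.objOver σ) (c.isGlobal σ)).apply_symm_apply _

theorem altSum_eq_boundary (σ : Fin 4 → I) : c.altSum X σ = boundary U X.L' (c.cochain X) σ := by
  rw [boundary_apply]
  refine Finset.sum_congr rfl fun k _ => congrArg _ ?_
  refine Multiplicative.ofAdd.injective ((MulEquiv.symm_apply_eq _).2 ?_)
  refine Eq.trans ?_ (X.aut_res (interMap U σ k.succAbove) (c.objOver (σ ∘ k.succAbove))
    (c.isGlobal _) (c.cochain X _))
  rw [aut_cochain]
  rfl

/-- Both sections act on the same object of `F₁` as the classifying automorphism, up to transport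
along the equality `e`. -/
theorem π_cochain (σ : Fin 3 → I) : (X.π.hom.app _).hom (c.cochain X σ) = b.cocycle σ := by
  have e : (T.down 0 _).obj (c.objOver σ) = T.restrObj U b.obj σ 2 := Subtype.ext (c.obj σ).2
  have h := X.aut_π (c.objOver σ) (c.isGlobal σ) (c.cochain X σ)
  rw [aut_cochain] at h
  have h₁ := T.projBanding.aut_naturality (eqToHom e) ((X.π.hom.app _).hom (c.cochain X σ))
  have h₂ : (T.down 0 _).map (c.lift σ).hom ≫ eqToHom e = eqToHom e ≫ (b.classifying σ).hom := by
    refine Subtype.ext ?_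
    have hl := c.isLift σ
    have h₃ := (IsHomLift.commSq (T.p 0) (b.classifying σ).hom.1 (c.lift σ).hom.1).w
    change (T.p 0).map (c.lift σ).hom.1 ≫ (eqToHom e).1 = (eqToHom e).1 ≫ _
    rw [eqToHom_fibre_val]
    exact h₃
  refine Multiplicative.ofAdd.injective ((T.projBanding.aut (T.restrObj U b.obj σ 2)).injective
    (Iso.ext ((cancel_epi (eqToHom e)).1 ?_)))
  rw [← h₁, b.aut_cocycle, ← h₂]
  exact congrArg (fun a => a.hom ≫ eqToHom e) h.symm

theorem π_altSum (σ : Fin 4 → I) : (X.π.hom.app _).hom (c.altSum X σ) = 0 := by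
  rw [altSum_eq_boundary, boundary_naturality]
  simp only [π_cochain]
  exact congrFun b.boundary_cocycle σ

theorem down_higher (σ : Fin 4 → I) :
    (T.down 0 _).mapAut (c.restrObj σ 3) (c.higher X σ) = 1 := by
  rw [higher, X.aut_π, π_altSum, ofAdd_zero]
  exact map_one (T.projBanding.aut _)

/-- Turns a condition on automorphisms into an equation in `L₂'`, where boundaries can be computed.
-/
theorem isClassifying_iff (s : Cochain U (T.L 1) 3) :
    c.IsClassifying X s ↔ ∀ σ, (X.ι.hom.app _).hom (s σ) = c.altSum X σ := by
  constructor
  · intro h σ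
    obtain ⟨hσ⟩ := c.isGlobal_restrObj σ 3
    refine Multiplicative.ofAdd.injective ((X.aut (c.restrObj σ 3) ⟨hσ⟩).injective ?_)
    exact (X.aut_ι _ hσ _).trans (h σ hσ)
  · intro h σ hσ
    rw [← X.aut_ι, h]
    rfl

theorem exists_isClassifying : ∃ s, c.IsClassifying X s := by
  have h (σ : Fin 4 → I) := (c.isGlobal_restrObj σ 3).some
  choose s hs using fun σ =>
    T.exists_bandAut_eq 0 hn (c.restrObj σ 3) (h σ) _ (c.down_higher X σ)
  -- The section was chosen for one witness of terminality; all witnesses are equal.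
  exact ⟨s, fun σ hσ => Subsingleton.elim (h σ) hσ ▸ hs σ⟩

variable {X c}

theorem IsClassifying.unique {s s' : Cochain U (T.L 1) 3} (hs : c.IsClassifying X s)
    (hs' : c.IsClassifying X s') : s' = s := by
  rw [isClassifying_iff] at hs hs'
  exact funext fun σ => X.ι_injective _ (c.isGlobal_restrObj σ 3) ((hs' σ).trans (hs σ).symm)

theorem IsClassifying.isCocycle {s : Cochain U (T.L 1) 3} (hs : c.IsClassifying X s) :
    IsCocycle U (T.L 1) s := by
  rw [isClassifying_iff] at hs
  funext σ
  -- Injectivity needs some global object over the fivefold product; one restricted from the face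
  -- omitting the first index serves.
  refine X.ι_injective _ (T.isGlobal_res 0 (interMap U σ (Fin.succAbove 0)) _
    (c.isGlobal_restrObj (σ ∘ Fin.succAbove 0) 3)) ?_
  rw [boundary_naturality]
  simp only [hs, altSum_eq_boundary]
  exact (congrFun (boundary_boundary U X.L' (c.cochain X)) σ).trans (map_zero _).symm

end LiftChoice

end GerbedTower
end GerbeTheory

theorem proposition4p2p1 {E : Type u} [Category.{v} E] [HasFiniteLimits E]
    (J : GrothendieckTopology E) (n : ℕ) (hn : 2 ≤ n)
    (T : GerbeTheory.GerbedTower.{w, v, u, v₁, u₁, v₂, u₂} J n) (X : T.ExtendedBand hn)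
    {I : Type u₃} (U : I → E) (hU : J.CoversTop U) (b : T.BaseChoice U) :
    ((∀ σ : Fin 3 → I,
        (∃ V : (T.p 0).Fiber (T.restrObj U b.obj σ 2).1, T.IsGlobal 0 V.1) ∧
        ∀ V V' : (T.p 0).Fiber (T.restrObj U b.obj σ 2).1,
          T.IsGlobal 0 V.1 → T.IsGlobal 0 V'.1 → Nonempty (V ≅ V')) →
      Nonempty (GerbeTheory.GerbedTower.LiftChoice b)) ∧
    ∀ c : GerbeTheory.GerbedTower.LiftChoice b,
      ∃ s : GerbeTheory.Cochain U (T.L 1) 3,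
        c.IsClassifying X s ∧
        (∀ s' : GerbeTheory.Cochain U (T.L 1) 3, c.IsClassifying X s' → s' = s) ∧
        GerbeTheory.IsCocycle U (T.L 1) s := by
  refine ⟨GerbeTheory.GerbedTower.LiftChoice.nonempty b, fun c => ?_⟩
  obtain ⟨s, hs⟩ := c.exists_isClassifying X
  exact ⟨s, hs, fun _ hs' => hs.unique hs', hs.isCocycle⟩
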